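/- All spaces are Tychonoff (completely regular and $T_1$). A space $Z$ is pseudocompact if every continuous function $Z\to\mathbb R$ is bounded; a subset $A\subseteq Z$ is bounded in $Z$ if every continuous function $Z\to\mathbb R$ is bounded on $A$. A space is $\sigma$-pseudocompact (respectively $\sigma$-bounded) if it is a union of countably many pseudocompact subspaces (respectively of countably many subsets that are bounded in it). A space $Z$ is Menger if for every sequence $(\mathcal U_n)_{n\in\mathbb N}$ of open covers of $Z$ there are finite subfamilies $\mathcal V_n\subseteq\mathcal U_n$ such that $\bigcup_{n}\mathcal V_n$ covers $Z$; it is projectively Menger if every second countable (Tychonoff) continuous image of $Z$ is Menger. A subset $S\subseteq X$ is $C^*$-embedded in $X$ if every bounded continuous function $S\to\mathbb R$ extends to a bounded continuous function $X\to\mathbb R$. **Theorem 4.5.** Let $X$ be a Tychonoff space and let $Y$ be a dense subset of $X$. Let $C_p(Y|X)=\{f|_Y : f\colon X\to\mathbb R \text{ continuous}\}$, with the topology of pointwise convergence on $Y$ (the subspace topology from $\mathbb R^Y$). The following statements are equivalent: 1. $C_p(Y|X)$ is projectively Menger; 2. $C_p(Y|X)$ is $\sigma$-bounded; 3. $C_p(Y|X)$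 is $\sigma$-pseudocompact; 4. $X$ is pseudocompact and $b_Y$-discrete, that is, every countable subset of $Y$ is closed in $Y$ and $C^*$-embedded in $X$. -/

import Mathlib

universe u

/-- `A` is bounded in `X`: every continuous real-valued function on `X` is bounded on `A`. -/
def IsFunctionallyBounded {X : Type u} [TopologicalSpace X] (A : Set X) : Prop :=
  ∀ f : X → ℝ, Continuous f → Bornology.IsBounded (f '' A)

/-- `X` is pseudocompact: every continuous real-valued function on `X` is bounded. -/
def IsPseudocompactSpace (X : Type u) [TopologicalSpace X] : Prop :=
  ∀ f : X → ℝ, Continuous f → Bornology.IsBounded (Set.range f)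

/-- `X` is a countable union of subsets that are bounded in `X`. -/
def IsSigmaBoundedSpace (X : Type u) [TopologicalSpace X] : Prop :=
  ∃ A : ℕ → Set X, (∀ i, IsFunctionallyBounded (A i)) ∧ (⋃ i, A i) = Set.univ

/-- `X` is a countable union of pseudocompact subspaces. -/
def IsSigmaPseudocompactSpace (X : Type u) [TopologicalSpace X] : Prop :=
  ∃ A : ℕ → Set X, (∀ i, IsPseudocompactSpace (A i)) ∧ (⋃ i, A i) = Set.univ

/-- The Menger covering property: from every sequence of open covers one can choose finite
subfamilies whose union covers `X`. -/
def IsMengerSpace (X : Type u) [TopologicalSpace X] : Prop :=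
  ∀ U : ℕ → Set (Set X),
    (∀ n, (∀ O ∈ U n, IsOpen O) ∧ ⋃₀ U n = Set.univ) →
      ∃ V : ℕ → Set (Set X),
        (∀ n, V n ⊆ U n ∧ (V n).Finite) ∧ (⋃ n, ⋃₀ V n) = Set.univ

/-- `X` is projectively Menger: every second countable (Tychonoff) continuous image of `X` is
Menger. An image of `X` is in bijection with a quotient of `X`, so that testing on images in the
universe of `X` is no restriction. -/
def IsProjectivelyMenger (X : Type u) [TopologicalSpace X] : Prop :=
  ∀ (Z : Type u) [TopologicalSpace Z] [T35Space Z] [SecondCountableTopology Z] (f : X → Z),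
    Continuous f → Function.Surjective f → IsMengerSpace Z

/-- `S` is C*-embedded in `X`: every bounded continuous real-valued function on the subspace `S`
extends to a bounded continuous real-valued function on `X`. -/
def IsCStarEmbedded {X : Type u} [TopologicalSpace X] (S : Set X) : Prop :=
  ∀ f : BoundedContinuousFunction S ℝ, ∃ g : BoundedContinuousFunction X ℝ, ∀ s : S, g s = f s

/-- `X` is `b_Y`-discrete: every countable subset of `Y` is closed in the subspace `Y` and
C*-embedded in `X`. -/
def IsBDiscreteOn {X : Type u} [TopologicalSpace X] (Y : Set X) : Prop :=
  ∀ S : Set X, S ⊆ Y → S.Countable →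
    IsClosed ((fun y : Y => (y : X)) ⁻¹' S) ∧ IsCStarEmbedded S

/-- The underlying set of `C_p(Y|X)`: the restrictions to `Y` of the continuous real-valued
functions on `X` (such restrictions are continuous on `Y`). Coerced to a type, it carries the
subspace topology from the product `Y → ℝ`, which is the topology of pointwise convergence. -/
def CpRestrict {X : Type u} [TopologicalSpace X] (Y : Set X) : Set (Y → ℝ) :=
  {h | ∃ f : X → ℝ, Continuous f ∧ h = fun y : Y => f y}

open Set Filter Topology

/-! ### Covering properties -/

/-! The implications form the cycle 1 → 4 → 3 → 2 → 1. For 1 → 4, restriction to a countable S ⊆ Y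
maps C_p(Y|X) onto the second countable space C_p(S|X), and its Menger property says that no
function evades a suitable sequence of finite choices. An unbounded function on X, or two disjoint
countable subsets of Y that no continuous function keeps a positive distance apart, would yield an
evading function (`IsProjectivelyMenger.isPseudocompactSpace`,
`IsProjectivelyMenger.exists_continuous_separating`). Separation gives indicators, and binary
expansions turn these into C*-embedding.

For 4 → 3, pseudocompactness of X makes the sup-norm balls of integer radius exhaust C_p(Y|X). Each
ball interpolates arbitrary bounded data on countable sets, so an ultrafilter limit argument shows
that it is pseudocompact. For 2 → 1, a bounded subset of a second countable metrizable space lies in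
finitely many members of any open cover. -/

theorem IsMengerSpace.exists_finset {Z : Type*} [TopologicalSpace Z] (hZ : IsMengerSpace Z)
    {ι : Type*} (O : ℕ → ι → Set Z) (hO : ∀ n i, IsOpen (O n i))
    (hcov : ∀ n z, ∃ i, z ∈ O n i) :
    ∃ T : ℕ → Finset ι, ∀ z, ∃ n, ∃ i ∈ T n, z ∈ O n i := by
  classical
  obtain ⟨V, hV, hVc⟩ := hZ (fun n => range (O n)) fun n =>
    ⟨by rintro _ ⟨i, rfl⟩; exact hO n i, eq_univ_of_forall fun z => by
      obtain ⟨i, hi⟩ := hcov n z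
      exact ⟨_, ⟨i, rfl⟩, hi⟩⟩
  have key : ∀ n, ∃ T : Finset ι, V n = O n '' (T : Set ι) := fun n => by
    obtain ⟨t, ht⟩ := (hV n).2.exists_finset_coe
    have hsub : (t : Set (Set Z)) ⊆ O n '' univ := by
      rw [ht, image_univ]
      exact (hV n).1
    obtain ⟨s, -, hs⟩ := Finset.subset_set_image_iff.1 hsub
    exact ⟨s, by rw [← ht, ← hs, Finset.coe_image]⟩
  choose T hT using key
  refine ⟨T, fun z => ?_⟩
  obtain ⟨n, s, hs, hz⟩ := mem_iUnion.1 (hVc.symm ▸ mem_univ z)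
  rw [hT n] at hs
  obtain ⟨i, hi, rfl⟩ := hs
  exact ⟨n, i, hi, hz⟩

theorem IsFunctionallyBounded.image {X Z : Type*} [TopologicalSpace X] [TopologicalSpace Z]
    {A : Set X} (hA : IsFunctionallyBounded A) {f : X → Z} (hf : Continuous f) :
    IsFunctionallyBounded (f '' A) := fun g hg => by
  rw [← image_comp]
  exact hA _ (hg.comp hf)

/-- In a metrizable space, finitely many members of a countable open cover already cover a
functionally bounded set. -/
theorem IsFunctionallyBounded.subset_iUnion_lt {Z : Type*} [TopologicalSpace Z]
    [TopologicalSpace.PseudoMetrizableSpace Z] {A : Set Z} (hA : IsFunctionallyBounded A)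
    {U : ℕ → Set Z} (hU : ∀ n, IsOpen (U n)) (hcov : ⋃ n, U n = univ) :
    ∃ N, A ⊆ ⋃ n < N, U n := by
  let := TopologicalSpace.pseudoMetrizableSpacePseudoMetric Z
  have hpos : ∀ n, ∃ f : Z → ℝ, Continuous f ∧ (∀ z, 0 ≤ f z) ∧ ∀ z, 0 < f z ↔ z ∈ U n := fun n => by
    rcases (U n)ᶜ.eq_empty_or_nonempty with h | h
    · refine ⟨fun _ => 1, continuous_const, fun _ => zero_le_one, fun z => ?_⟩
      simp [compl_empty_iff.1 h]
    · refine ⟨fun z => Metric.infDist z (U n)ᶜ, Metric.continuous_infDist_pt _,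
        fun z => Metric.infDist_nonneg, fun z => ?_⟩
      rw [← (hU n).isClosed_compl.notMem_iff_infDist_pos h, notMem_compl_iff]
  choose f hfc hf0 hfU using hpos
  set u : ℕ → ℝ := fun n => (1 / 2) ^ n with hu
  have hus : Summable u := summable_geometric_two
  set g : ℕ → Z → ℝ := fun n z => min (u n) (f n z) with hg
  have hg0 : ∀ n z, 0 ≤ g n z := fun n z => le_min (by positivity) (hf0 n z)
  have hgu : ∀ n z, ‖g n z‖ ≤ u n := fun n z => by
    rw [Real.norm_of_nonneg (hg0 n z)]
    exact min_le_left _ _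
  have hgs : ∀ z, Summable fun n => g n z := fun z => hus.of_norm_bounded fun n => hgu n z
  have hFc : Continuous fun z => ∑' n, g n z :=
    continuous_tsum (fun n => continuous_const.min (hfc n)) hus hgu
  have hFpos : ∀ z, 0 < ∑' n, g n z := fun z => by
    obtain ⟨n, hn⟩ := mem_iUnion.1 (hcov.symm ▸ mem_univ z)
    exact (hgs z).tsum_pos (fun n => hg0 n z) n (lt_min (by positivity) ((hfU n z).2 hn))
  -- Boundedness of the reciprocal keeps the sum above a positive constant on `A`, whereas a point
  -- outside the first `N` sets sees only a tail of the series, which is smaller.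
  obtain ⟨C, hC⟩ := isBounded_iff_forall_norm_le.1
    (hA _ (hFc.inv₀ fun z => (hFpos z).ne'))
  have htail := tendsto_sum_nat_add u
  obtain ⟨N, hN⟩ := (htail.eventually (gt_mem_nhds (show (0 : ℝ) < (|C| + 1)⁻¹ by positivity))).exists
  refine ⟨N, fun z hz => ?_⟩
  by_contra hzN
  simp only [mem_iUnion, not_exists] at hzN
  have hzero : ∀ n ∈ Finset.range N, g n z = 0 := fun n hn => by
    have : ¬ 0 < f n z := fun h => hzN n (Finset.mem_range.1 hn) ((hfU n z).1 h)
    have h0 : f n z = 0 := le_antisymm (not_lt.1 this) (hf0 n z)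
    simp only [hg, h0]
    exact min_eq_right (by positivity)
  have h1 : ∑' n, g n z ≤ ∑' n, u (n + N) := by
    rw [← (hgs z).sum_add_tsum_nat_add N, Finset.sum_eq_zero hzero, zero_add]
    exact ((summable_nat_add_iff N).2 (hgs z)).tsum_le_tsum
      (fun n => min_le_left _ _) ((summable_nat_add_iff N).2 hus)
  have h2 : (∑' n, g n z)⁻¹ ≤ C := (le_abs_self _).trans (hC _ (mem_image_of_mem _ hz))
  have h3 : (∑' n, g n z)⁻¹ < |C| + 1 := by linarith [le_abs_self C]
  have h4 := inv_lt_of_inv_lt₀ (hFpos z) h3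
  linarith

theorem IsSigmaBoundedSpace.isMengerSpace {Z : Type*} [TopologicalSpace Z]
    [TopologicalSpace.PseudoMetrizableSpace Z] [SecondCountableTopology Z]
    (hZ : IsSigmaBoundedSpace Z) : IsMengerSpace Z := fun U hU => by
  obtain ⟨A, hA, hAc⟩ := hZ
  have key : ∀ n, ∃ V ⊆ U n, V.Finite ∧ A n ⊆ ⋃₀ V := fun n => by
    obtain ⟨c, hcc, hcU, hcov⟩ := TopologicalSpace.isOpen_sUnion_countable (U n) (hU n).1
    rw [(hU n).2] at hcov
    rcases c.eq_empty_or_nonempty with rfl | hne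
    · refine ⟨∅, empty_subset _, finite_empty, fun z _ => ?_⟩
      rw [hcov]
      trivial
    · obtain ⟨e, rfl⟩ := hcc.exists_eq_range hne
      obtain ⟨N, hN⟩ := (hA n).subset_iUnion_lt (fun k => (hU n).1 _ (hcU ⟨k, rfl⟩))
        (by rwa [sUnion_range] at hcov)
      refine ⟨e '' Iio N, (image_subset_range _ _).trans hcU, (finite_Iio N).image _, ?_⟩
      simpa [sUnion_image] using hN
  choose V hVU hVf hAV using key
  exact ⟨V, fun n => ⟨hVU n, hVf n⟩, univ_subset_iff.1 (hAc ▸ iUnion_mono hAV)⟩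

theorem IsSigmaBoundedSpace.isProjectivelyMenger {X : Type u} [TopologicalSpace X]
    (hX : IsSigmaBoundedSpace X) : IsProjectivelyMenger X := by
  intro Z _ _ _ f hf hfs
  obtain ⟨A, hA, hAc⟩ := hX
  refine IsSigmaBoundedSpace.isMengerSpace ⟨fun n => f '' A n, fun n => (hA n).image hf, ?_⟩
  rw [← image_iUnion, hAc, image_univ, hfs.range_eq]

theorem IsSigmaPseudocompactSpace.isSigmaBoundedSpace {X : Type*} [TopologicalSpace X]
    (hX : IsSigmaPseudocompactSpace X) : IsSigmaBoundedSpace X := by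
  obtain ⟨A, hA, hAc⟩ := hX
  refine ⟨A, fun n f hf => ?_, hAc⟩
  have := hA n _ (hf.comp continuous_subtype_val)
  rwa [range_comp, Subtype.range_coe] at this

/-! ### Restrictions to countable subsets -/

theorem CpRestrict.continuous_eval {X : Type*} [TopologicalSpace X] {Y : Set X} (y : Y) :
    Continuous fun p : CpRestrict Y => p.1 y :=
  (continuous_apply y).comp continuous_subtype_val

theorem IsProjectivelyMenger.isMengerSpace_cpRestrict {X : Type u} [TopologicalSpace X]
    {Y S : Set X} (h : IsProjectivelyMenger (CpRestrict Y)) (hSY : S ⊆ Y) (hS : S.Countable) :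
    IsMengerSpace (CpRestrict S) := by
  have := hS.to_subtype
  refine h (CpRestrict S) (fun p => ⟨fun s => p.1 ⟨s, hSY s.2⟩, ?_⟩) ?_ ?_
  · obtain ⟨_, f, hf, rfl⟩ := p
    exact ⟨f, hf, rfl⟩
  · exact continuous_induced_rng.2 (continuous_pi fun s : S =>
      CpRestrict.continuous_eval ⟨s.1, hSY s.2⟩)
  · rintro ⟨_, f, hf, rfl⟩
    exact ⟨⟨_, f, hf, rfl⟩, rfl⟩

/-- Composing such a `φ` with an unbounded function outgrows any prescribed sequence of finite
choices. The constraints are convex and locally bounded, so a partition of unity glues local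
constants. -/
theorem exists_continuous_forall_ge (k : ℕ → ℝ) :
    ∃ φ : C(ℝ, ℝ), ∀ (n : ℕ) (t : ℝ), n ≤ t → k n ≤ φ t := by
  obtain ⟨φ, hφ⟩ := exists_continuous_forall_mem_convex_of_local_const
    (t := fun t : ℝ => ⋂ (n : ℕ) (_ : (n : ℝ) ≤ t), Ici (k n))
    (fun t => convex_iInter fun n => convex_iInter fun _ => convex_Ici _) fun t => by
      obtain ⟨N, hN⟩ := exists_nat_gt t
      refine ⟨∑ i ∈ Finset.range N, |k i|, ?_⟩
      filter_upwards [gt_mem_nhds hN] with s hs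
      simp only [mem_iInter, mem_Ici]
      intro n hn
      have hnN : n < N := by exact_mod_cast hn.trans_lt hs
      exact (le_abs_self _).trans (Finset.single_le_sum (f := fun i => |k i|)
        (fun i _ => abs_nonneg _) (Finset.mem_range.2 hnN))
  refine ⟨φ, fun n t hn => ?_⟩
  have := hφ t
  simp only [mem_iInter, mem_Ici] at this
  exact this n hn

theorem IsProjectivelyMenger.isPseudocompactSpace {X : Type u} [TopologicalSpace X]
    {Y : Set X} (hY : Dense Y) (h : IsProjectivelyMenger (CpRestrict Y)) :
    IsPseudocompactSpace X := by
  intro f hf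
  by_contra hb
  have hunb : ∀ n : ℕ, ∃ y ∈ Y, (n : ℝ) < |f y| := fun n => by
    by_contra! hn
    refine hb (isBounded_iff_forall_norm_le.2 ⟨n, ?_⟩)
    rintro _ ⟨x, rfl⟩
    exact (isClosed_le hf.abs continuous_const).closure_subset_iff.2 hn (hY x)
  choose y hyY hy using hunb
  have hM := h.isMengerSpace_cpRestrict (range_subset_iff.2 hyY) (countable_range y)
  obtain ⟨T, hT⟩ := hM.exists_finset
    (fun n (k : ℕ) => {p : CpRestrict (range y) | p.1 ⟨y n, n, rfl⟩ < k})
    (fun n k => isOpen_lt (CpRestrict.continuous_eval _) continuous_const)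
    (fun n p => exists_nat_gt (p.1 ⟨y n, n, rfl⟩))
  -- Since `|f (y n)| > n`, the value of `φ ∘ |f|` at `y n` is at least every bound in `T n`, so
  -- this function evades every choice.
  obtain ⟨φ, hφ⟩ := exists_continuous_forall_ge fun n => ((T n).sup id : ℕ)
  obtain ⟨n, k, hk, hlt⟩ := hT ⟨_, fun x => φ |f x|, φ.continuous.comp hf.abs, rfl⟩
  have h1 : ((T n).sup id : ℕ) ≤ φ |f (y n)| := hφ n _ (hy n).le
  have h2 : (k : ℝ) ≤ ((T n).sup id : ℕ) := by
    exact_mod_cast Finset.le_sup (f := id) hk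
  have h3 : φ |f (y n)| < k := hlt
  linarith

/-! ### Separation of countable subsets -/

theorem exists_continuous_eqOn_finset {X : Type*} [TopologicalSpace X] [T35Space X]
    (T : Finset X) (v : X → ℝ) {δ : ℝ} (hv : ∀ x ∈ T, |v x| ≤ δ) (hδ : 0 ≤ δ) :
    ∃ g : X → ℝ, Continuous g ∧ (∀ x, |g x| ≤ δ) ∧ ∀ x ∈ T, g x = v x := by
  classical
  have key : ∃ g : X → ℝ, Continuous g ∧ ∀ x ∈ T, g x = v x := by
    clear hv
    induction T using Finset.induction_on with
    | empty => exact ⟨fun _ => 0, continuous_const, by simp⟩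
    | insert a T ha ih =>
      obtain ⟨g, hg, hgT⟩ := ih
      obtain ⟨w, hw, hwa, hwT⟩ := CompletelyRegularSpace.completely_regular a (T : Set X)
        T.finite_toSet.isClosed (by simpa using ha)
      refine ⟨fun x => g x + (1 - (w x : ℝ)) * (v a - g a),
        hg.add ((continuous_const.sub (continuous_subtype_val.comp hw)).mul continuous_const), ?_⟩
      intro x hx
      rcases Finset.mem_insert.1 hx with rfl | hx
      · simp [hwa]
      · have h1 : w x = 1 := hwT hx
        simp [h1, hgT x hx]
  obtain ⟨g, hg, hgT⟩ := key
  refine ⟨fun x => max (-δ) (min δ (g x)), continuous_const.max (continuous_const.min hg),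
    fun x => abs_le.2 ⟨le_max_left _ _, max_le (by linarith) (min_le_left _ _)⟩, fun x hx => ?_⟩
  have := abs_le.1 (hv x hx)
  simp only [hgT x hx]
  rw [min_eq_right this.2, max_eq_right this.1]

theorem exists_int_abs_even_sub_le {δ : ℝ} (hδ : 0 < δ) (t : ℝ) :
    ∃ k : ℤ, |2 * k * δ - t| ≤ δ := by
  refine ⟨round (t / (2 * δ)), ?_⟩
  have h := abs_sub_round (t / (2 * δ))
  have h2 : 2 * (round (t / (2 * δ)) : ℝ) * δ - t
      = -(2 * δ) * (t / (2 * δ) - round (t / (2 * δ))) := by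
    field_simp
    ring
  rw [h2, abs_mul, abs_neg, abs_of_pos (by positivity : 0 < 2 * δ)]
  nlinarith

/-- A small perturbation makes a continuous function take well separated values on two finite
disjoint sets: round it to even multiples of `δ` on one and odd multiples on the other. -/
theorem exists_perturbation_separating {X : Type*} [TopologicalSpace X] [T35Space X]
    {A B : Set X} (hAB : Disjoint A B) (T : Finset X) {δ : ℝ} (hδ : 0 < δ) (F : C(X, ℝ)) :
    ∃ G : C(X, ℝ), (∀ x, |G x - F x| ≤ δ) ∧
      ∀ a ∈ T, ∀ b ∈ T, a ∈ A → b ∈ B → δ ≤ |G a - G b| := by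
  classical
  choose e he using exists_int_abs_even_sub_le hδ
  set w : X → ℝ := fun x =>
    if x ∈ A then 2 * e (F x) * δ - F x else 2 * e (F x - δ) * δ - (F x - δ) with hw
  obtain ⟨g, hg, hgδ, hgT⟩ := exists_continuous_eqOn_finset T w (δ := δ) (fun x _ => by
    simp only [hw]
    split_ifs
    exacts [he _, he _]) hδ.le
  refine ⟨F + ⟨g, hg⟩, fun x => by simpa using hgδ x, fun a ha b hb haA hbB => ?_⟩
  have hbA : b ∉ A := fun h => hAB.le_bot ⟨h, hbB⟩
  have h1 : (F + ⟨g, hg⟩ : C(X, ℝ)) a - (F + ⟨g, hg⟩ : C(X, ℝ)) b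
      = ((2 * (e (F a) - e (F b - δ)) - 1 : ℤ) : ℝ) * δ := by
    simp only [ContinuousMap.add_apply, ContinuousMap.coe_mk, hgT a ha, hgT b hb, hw, haA, hbA,
      if_true, if_false]
    push_cast
    ring
  rw [h1, abs_mul, abs_of_pos hδ]
  have h2 : (1 : ℤ) ≤ |2 * (e (F a) - e (F b - δ)) - 1| := Int.one_le_abs (by omega)
  have h3 : (1 : ℝ) ≤ |((2 * (e (F a) - e (F b - δ)) - 1 : ℤ) : ℝ)| := by
    rw [← Int.cast_abs]
    exact_mod_cast h2
  nlinarith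

/-- Stage `n` perturbs by at most `(1/8)^n` to create a gap `(1/8)^n` on `T n`. All later stages
together move each value by at most `(1/8)^n / 7`, so at least 5/7 of the gap survives in the
uniform limit. -/
theorem exists_continuous_separating_finsets {X : Type*} [TopologicalSpace X] [T35Space X]
    {A B : Set X} (hAB : Disjoint A B) (T : ℕ → Finset X) :
    ∃ f : X → ℝ, Continuous f ∧ ∀ n, ∀ a ∈ T n, ∀ b ∈ T n, a ∈ A → b ∈ B →
      (1 / 8) ^ n / 2 ≤ |f a - f b| := by
  choose G hGF hG using fun (n : ℕ) (F : C(X, ℝ)) =>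
    exists_perturbation_separating hAB (T n) (δ := (1 / 8) ^ n) (by positivity) F
  let F : ℕ → C(X, ℝ) := fun n => Nat.rec 0 (fun n F => G n F) n
  have hF : ∀ x n, dist (F n x) (F (n + 1) x) ≤ 1 * (1 / 8) ^ n := fun x n => by
    rw [dist_comm, Real.dist_eq, one_mul]
    exact hGF n (F n) x
  have hlim : ∀ x, ∃ y, Tendsto (fun n => F n x) atTop (𝓝 y) := fun x =>
    cauchySeq_tendsto_of_complete (cauchySeq_of_le_geometric _ _ (by norm_num) (hF x))
  choose f hf using hlim
  have hdist : ∀ x n, dist (F n x) (f x) ≤ 1 * (1 / 8) ^ n / (1 - 1 / 8) := fun x n =>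
    dist_le_of_le_geometric_of_tendsto _ _ (by norm_num) (hF x) (hf x) n
  refine ⟨f, ?_, fun n a ha b hb haA hbB => ?_⟩
  · have hz : Tendsto (fun n : ℕ => (1 : ℝ) * (1 / 8) ^ n / (1 - 1 / 8)) atTop (𝓝 0) := by
      have := (tendsto_pow_atTop_nhds_zero_of_lt_one (r := (1 / 8 : ℝ)) (by norm_num)
        (by norm_num)).const_mul 1 |>.div_const (1 - 1 / 8)
      simpa using this
    have hu : TendstoUniformly (fun n x => F n x) f atTop := by
      rw [Metric.tendstoUniformly_iff]
      intro ε hε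
      filter_upwards [hz.eventually (gt_mem_nhds hε)] with n hn x
      rw [dist_comm]
      exact (hdist x n).trans_lt hn
    exact hu.continuous (Frequently.of_forall fun n => (F n).continuous)
  · have h1 : (1 / 8 : ℝ) ^ n ≤ |F (n + 1) a - F (n + 1) b| := hG n (F n) a ha b hb haA hbB
    have h2 := hdist a (n + 1)
    have h3 := hdist b (n + 1)
    rw [Real.dist_eq, pow_succ] at h2 h3
    have hp : (0 : ℝ) < (1 / 8) ^ n := by positivity
    have h4 : |F (n + 1) a - F (n + 1) b| ≤
        |F (n + 1) a - f a| + |f a - f b| + |F (n + 1) b - f b| := by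
      calc |F (n + 1) a - F (n + 1) b|
          = |(F (n + 1) a - f a) + (f a - f b) + -(F (n + 1) b - f b)| := by ring_nf
        _ ≤ _ := (abs_add_three _ _ _).trans_eq (by rw [abs_neg])
    clear_value F
    norm_num at h2 h3
    generalize (1 / 8 : ℝ) ^ n = d at h1 h2 h3 hp ⊢
    linarith

/-- If every continuous function brings some pair from `A × B` arbitrarily close, then for each `n`
the sets of functions with gap below `(1/8)^n / 2` at a given pair form a cover. A function
separating all the finitely many chosen pairs at every stage contradicts Menger. -/
theorem IsProjectivelyMenger.exists_continuous_separating {X : Type u} [TopologicalSpace X]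
    [T35Space X] {Y A B : Set X} (h : IsProjectivelyMenger (CpRestrict Y)) (hA : A ⊆ Y)
    (hB : B ⊆ Y) (hAc : A.Countable) (hBc : B.Countable) (hAB : Disjoint A B) :
    ∃ f : X → ℝ, Continuous f ∧ ∃ ε > 0, ∀ a ∈ A, ∀ b ∈ B, ε ≤ |f a - f b| := by
  classical
  by_contra! hcon
  have hM := h.isMengerSpace_cpRestrict (union_subset hA hB) (hAc.union hBc)
  obtain ⟨T, hT⟩ := hM.exists_finset
    (fun n (i : A × B) => {p : CpRestrict (A ∪ B) |
      |p.1 ⟨i.1, Or.inl i.1.2⟩ - p.1 ⟨i.2, Or.inr i.2.2⟩| < (1 / 8) ^ n / 2})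
    (fun n i => isOpen_lt ((CpRestrict.continuous_eval _).sub
      (CpRestrict.continuous_eval _)).abs continuous_const)
    (by
      rintro n ⟨_, f, hf, rfl⟩
      obtain ⟨a, ha, b, hb, hab⟩ := hcon f hf ((1 / 8) ^ n / 2) (by positivity)
      exact ⟨(⟨a, ha⟩, ⟨b, hb⟩), hab⟩)
  obtain ⟨f, hf, hfT⟩ := exists_continuous_separating_finsets hAB fun n =>
    (T n).image (fun i => (i.1 : X)) ∪ (T n).image (fun i => (i.2 : X))
  obtain ⟨n, i, hi, hlt⟩ := hT ⟨_, f, hf, rfl⟩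
  have hge := hfT n i.1 (Finset.mem_union_left _ (Finset.mem_image_of_mem _ hi)) i.2
    (Finset.mem_union_right _ (Finset.mem_image_of_mem _ hi)) i.1.2 i.2.2
  exact absurd hlt (not_lt.2 hge)

theorem exists_continuous_indicator_of_separating {X : Type*} [TopologicalSpace X]
    {A B : Set X} {f : X → ℝ} (hf : Continuous f) {ε : ℝ} (hε : 0 < ε)
    (hAB : ∀ a ∈ A, ∀ b ∈ B, ε ≤ |f a - f b|) :
    ∃ g : X → ℝ, Continuous g ∧ (∀ x, g x ∈ Icc (0 : ℝ) 1) ∧ (∀ a ∈ A, g a = 1) ∧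
      ∀ b ∈ B, g b = 0 := by
  rcases A.eq_empty_or_nonempty with rfl | hne
  · exact ⟨fun _ => 0, continuous_const, by simp, by simp, by simp⟩
  · refine ⟨fun x => max 0 (1 - Metric.infDist (f x) (f '' A) / ε),
      continuous_const.max (continuous_const.sub
        (((Metric.continuous_infDist_pt _).comp hf).div_const _)),
      fun x => ⟨le_max_left _ _, max_le zero_le_one ?_⟩, fun a ha => ?_, fun b hb => ?_⟩
    · have : 0 ≤ Metric.infDist (f x) (f '' A) / ε := div_nonneg Metric.infDist_nonneg hε.le
      linarith
    · simp [Metric.infDist_zero_of_mem (mem_image_of_mem f ha)]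
    · refine max_eq_left ?_
      have : ε ≤ Metric.infDist (f b) (f '' A) := by
        refine (Metric.le_infDist (hne.image f)).2 ?_
        rintro _ ⟨a, ha, rfl⟩
        rw [dist_comm, Real.dist_eq]
        exact hAB a ha b hb
      have := (one_le_div hε).2 this
      linarith

/-! ### Extension of bounded functions -/

/-- If all indicator functions of subsets of `S` extend continuously with values in `[0, 1]`, so
do all functions on `S` with values in `[0, 1]`; the extension is assembled from the binary
digits. -/
theorem exists_continuous_extension_of_indicators {X : Type*} [TopologicalSpace X] {S : Set X}
    (hS : ∀ A ⊆ S, ∃ g : X → ℝ, Continuous g ∧ (∀ x, g x ∈ Icc (0 : ℝ) 1) ∧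
      (∀ a ∈ A, g a = 1) ∧ ∀ b ∈ S \ A, g b = 0)
    (f : X → ℝ) (hf : ∀ s ∈ S, f s ∈ Icc (0 : ℝ) 1) :
    ∃ g : X → ℝ, Continuous g ∧ (∀ x, |g x| ≤ 2) ∧ ∀ s ∈ S, g s = f s := by
  classical
  -- `d` is the leading binary digit and `r n` the remainder after `n` doublings. On `S` the digit
  -- of `r n` is an indicator, extended by `g n`.
  let d : ℝ → ℝ := fun t => if 1 / 2 ≤ t then 1 else 0
  let r : ℕ → X → ℝ := fun n => Nat.rec f (fun _ ρ x => 2 * ρ x - d (ρ x)) n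
  have hr : ∀ n x, r (n + 1) x = 2 * r n x - d (r n x) := fun _ _ => rfl
  choose g hgc hg01 hg1 hg0 using fun n =>
    hS {s | s ∈ S ∧ 1 / 2 ≤ r n s} fun s hs => hs.1
  have hgr : ∀ n, ∀ s ∈ S, g n s = d (r n s) := fun n s hs => by
    simp only [d]
    split_ifs with h
    · exact hg1 n s ⟨hs, h⟩
    · exact hg0 n s ⟨hs, fun h' => h h'.2⟩
  have hr01 : ∀ n, ∀ s ∈ S, r n s ∈ Icc (0 : ℝ) 1 := fun n s hs => by
    induction n with
    | zero => exact hf s hs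
    | succ n ih =>
      simp only [hr, d]
      obtain ⟨h0, h1⟩ := ih
      split_ifs with h <;> constructor <;> linarith
  have hsum : ∀ n, ∀ s ∈ S, ∑ i ∈ Finset.range n, (1 / 2) ^ (i + 1) * g i s
      = f s - (1 / 2) ^ n * r n s := fun n s hs => by
    induction n with
    | zero => simp [r]
    | succ n ih =>
      rw [Finset.sum_range_succ, ih, hr, hgr n s hs]
      ring
  have hbound : ∀ n x, ‖(1 / 2 : ℝ) ^ (n + 1) * g n x‖ ≤ (1 / 2) ^ n := fun n x => by
    have h1 := hg01 n x
    rw [Real.norm_of_nonneg (mul_nonneg (by positivity) h1.1), pow_succ]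
    have hp : (0 : ℝ) < (1 / 2) ^ n := by positivity
    nlinarith [h1.2]
  have hsm : ∀ x, Summable fun n => (1 / 2 : ℝ) ^ (n + 1) * g n x := fun x =>
    summable_geometric_two.of_norm_bounded fun n => hbound n x
  refine ⟨fun x => ∑' n, (1 / 2 : ℝ) ^ (n + 1) * g n x,
    continuous_tsum (fun n => continuous_const.mul (hgc n)) summable_geometric_two hbound,
    fun x => ?_, fun s hs => ?_⟩
  · exact tsum_of_norm_bounded hasSum_geometric_two fun n => hbound n x
  · refine tendsto_nhds_unique (hsm s).hasSum.tendsto_sum_nat ?_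
    simp_rw [hsum _ s hs]
    have hz : Tendsto (fun n => (1 / 2 : ℝ) ^ n * r n s) atTop (𝓝 0) := by
      refine squeeze_zero (fun n => mul_nonneg (by positivity) (hr01 n s hs).1)
        (fun n => mul_le_of_le_one_right (by positivity) (hr01 n s hs).2) ?_
      exact tendsto_pow_atTop_nhds_zero_of_lt_one (by norm_num) (by norm_num)
    simpa using hz.const_sub (f s)

theorem isCStarEmbedded_of_indicators {X : Type*} [TopologicalSpace X] {S : Set X}
    (hS : ∀ A ⊆ S, ∃ g : X → ℝ, Continuous g ∧ (∀ x, g x ∈ Icc (0 : ℝ) 1) ∧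
      (∀ a ∈ A, g a = 1) ∧ ∀ b ∈ S \ A, g b = 0) : IsCStarEmbedded S := by
  classical
  intro f
  -- The added 1 keeps the rescaling of `[-M, M]` onto `[0, 1]` defined when `f = 0`.
  set M : ℝ := ‖f‖ + 1 with hM
  have hMpos : 0 < M := by positivity
  obtain ⟨g, hg, hg2, hgS⟩ := exists_continuous_extension_of_indicators hS
    (fun x => if h : x ∈ S then (f ⟨x, h⟩ + M) / (2 * M) else 0) fun s hs => by
      have h1 := abs_le.1 (f.norm_coe_le_norm ⟨s, hs⟩)
      simp only [hs, dif_pos]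
      exact ⟨div_nonneg (by linarith) (by positivity), (div_le_one (by positivity)).2 (by linarith)⟩
  refine ⟨BoundedContinuousFunction.ofNormedAddCommGroup (fun x => 2 * M * g x - M)
    ((continuous_const.mul hg).sub continuous_const) (5 * M) fun x => ?_, fun s => ?_⟩
  · have := abs_le.1 (hg2 x)
    rw [Real.norm_eq_abs, abs_le]
    constructor <;> nlinarith
  · have h := hgS s s.2
    simp only [Subtype.coe_prop, dif_pos, Subtype.coe_eta] at h
    simp only [BoundedContinuousFunction.coe_ofNormedAddCommGroup, h]
    field_simp
    ring

theorem IsProjectivelyMenger.isBDiscreteOn {X : Type u} [TopologicalSpace X] [T35Space X]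
    {Y : Set X} (h : IsProjectivelyMenger (CpRestrict Y)) : IsBDiscreteOn Y := by
  intro S hSY hS
  constructor
  · refine isClosed_of_closure_subset fun y hy => ?_
    by_contra hyS
    obtain ⟨f, hf, ε, hε, hfε⟩ := h.exists_continuous_separating hSY
      (singleton_subset_iff.2 y.2) hS (countable_singleton _) (disjoint_singleton_right.2 hyS)
    have hcl : IsClosed {z : Y | ε ≤ |f z - f y|} :=
      isClosed_le continuous_const ((hf.comp continuous_subtype_val).sub continuous_const).abs
    have : ε ≤ |f y - f y| := hcl.closure_subset_iff.2 (fun z hz => hfε z hz y rfl) hy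
    simp only [sub_self, abs_zero] at this
    linarith
  · refine isCStarEmbedded_of_indicators fun A hA => ?_
    obtain ⟨f, hf, ε, hε, hfε⟩ := h.exists_continuous_separating (hA.trans hSY)
      (sdiff_subset.trans hSY) (hS.mono hA) (hS.mono sdiff_subset) disjoint_sdiff_right
    exact exists_continuous_indicator_of_separating hf hε hfε

/-! ### Pseudocompactness of balls in the function space -/

theorem IsBDiscreteOn.exists_continuous_extension {X : Type*} [TopologicalSpace X] {Y : Set X}
    (hY : IsBDiscreteOn Y) {S : Set Y} (hS : S.Countable) (v : Y → ℝ) {M : ℝ} (hM : 0 ≤ M)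
    (hv : ∀ y, |v y| ≤ M) :
    ∃ f : X → ℝ, Continuous f ∧ (∀ x, |f x| ≤ M) ∧ ∀ y ∈ S, f y = v y := by
  set S' : Set X := (↑) '' S with hS'
  have hS'Y : S' ⊆ Y := by
    rintro _ ⟨y, -, rfl⟩
    exact y.2
  have hS'c : S'.Countable := hS.image _
  -- Every subset of `S'` is itself countable, hence closed in `Y`; thus any data on `S'` are
  -- continuous.
  have hdisc : DiscreteTopology S' := by
    refine discreteTopology_iff_forall_isClosed.2 fun T => ?_
    have hT := (hY ((↑) '' T) ((Subtype.coe_image_subset _ _).trans hS'Y)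
      (hS'c.mono (Subtype.coe_image_subset _ _))).1
    convert! hT.preimage (continuous_inclusion hS'Y) using 1
    ext s
    simp
  obtain ⟨g, hg⟩ := (hY S' hS'Y hS'c).2 (BoundedContinuousFunction.ofNormedAddCommGroup
    (fun s => v ⟨s, hS'Y s.2⟩) continuous_of_discreteTopology M fun s => hv _)
  refine ⟨fun x => max (-M) (min M (g x)), continuous_const.max (continuous_const.min g.continuous),
    fun x => abs_le.2 ⟨le_max_left _ _, max_le (by linarith) (min_le_left _ _)⟩, fun y hy => ?_⟩
  have h1 : g y = v y := hg ⟨y, y, hy, rfl⟩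
  have := abs_le.1 (hv y)
  simp only [h1]
  rw [min_eq_right this.2, max_eq_right this.1]

/-- A bounded family of real functions that interpolates all bounded functions on countable sets
is pseudocompact in the topology of pointwise convergence. -/
theorem isPseudocompactSpace_of_countable_interpolation {E ι : Type*} [TopologicalSpace E]
    {φ : E → ι → ℝ} (hφ : IsInducing φ) {M : ℝ} (hM : ∀ p i, |φ p i| ≤ M)
    (hint : ∀ S : Set ι, S.Countable → ∀ v : ι → ℝ, (∀ i, |v i| ≤ M) →
      ∃ p, ∀ i ∈ S, φ p i = v i) : IsPseudocompactSpace E := by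
  classical
  intro g hg
  by_contra hb
  have hunb : ∀ k : ℕ, ∃ p, (k : ℝ) < |g p| := fun k => by
    by_contra! hk
    refine hb (isBounded_iff_forall_norm_le.2 ⟨k, ?_⟩)
    rintro _ ⟨p, rfl⟩
    exact hk p
  choose p hp using hunb
  have hbasic : ∀ U : Set E, IsOpen U → ∀ q ∈ U, ∃ (F : Finset ι) (u : ι → Set ℝ),
      (∀ i ∈ F, IsOpen (u i) ∧ φ q i ∈ u i) ∧ ∀ q', (∀ i ∈ F, φ q' i ∈ u i) → q' ∈ U := by
    intro U hU q hq
    obtain ⟨V, hV, rfl⟩ := hφ.isOpen_iff.1 hU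
    obtain ⟨F, u, hu, hsub⟩ := isOpen_pi_iff.1 hV (φ q) hq
    exact ⟨F, u, hu, fun q' hq' => hsub hq'⟩
  choose F u hu hF using fun k : ℕ => hbasic {q | (k : ℝ) < |g q|}
    (isOpen_lt continuous_const hg.abs) (p k) (hp k)
  -- The points `p k` need not converge in `E`, but their coordinates do along `𝒰`, and some `h` in
  -- `E` realizes the limits on the countable set `S` of all coordinates controlling `|g| > k` near
  -- `p k`.
  let 𝒰 : Ultrafilter ℕ := hyperfilter ℕ
  have hlim : ∀ i, ∃ c ∈ Icc (-M) M, Tendsto (fun k => φ (p k) i) 𝒰 (𝓝 c) := fun i =>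
    isCompact_Icc.ultrafilter_le_nhds (𝒰.map fun k => φ (p k) i)
      (le_principal_iff.2 (Ultrafilter.mem_map.2 (univ_mem' fun k => abs_le.1 (hM _ _))))
  choose c hcM hc using hlim
  set S : Set ι := ⋃ k, (F k : Set ι) with hS
  have hSc : S.Countable := countable_iUnion fun k => (F k).countable_toSet
  obtain ⟨h, hh⟩ := hint S hSc c fun i => abs_le.2 (hcM i)
  obtain ⟨G, w, hw, hG⟩ := hbasic {q | |g q| < |g h| + 1}
    (isOpen_lt hg.abs continuous_const) h (lt_add_one |g h|)
  have hev : ∀ᶠ k in (𝒰 : Filter ℕ), ∀ i ∈ G, i ∈ S → φ (p k) i ∈ w i := by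
    rw [Filter.eventually_all_finset]
    intro i hi
    by_cases hiS : i ∈ S
    · have hmem := (hw i hi).2
      rw [hh i hiS] at hmem
      filter_upwards [(hc i).eventually ((hw i hi).1.mem_nhds hmem)] with k hk _ using hk
    · exact Eventually.of_forall fun k hk => absurd hk hiS
  have hlarge : ∀ᶠ k : ℕ in (𝒰 : Filter ℕ), |g h| + 1 ≤ k :=
    Nat.hyperfilter_le_atTop
      (tendsto_natCast_atTop_atTop.eventually (eventually_ge_atTop (|g h| + 1)))
  obtain ⟨k, hk, hkl⟩ := (hev.and hlarge).exists
  -- Splicing `p k` on `S` with `h` on `G \ S` puts `q` in both neighbourhoods, so `k < |g q| < |g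
  -- h| + 1 ≤ k`.
  obtain ⟨q, hq⟩ := hint (S ∪ G) (hSc.union G.countable_toSet)
    (fun i => if i ∈ S then φ (p k) i else φ h i) fun i => by
      split_ifs
      exacts [hM _ _, hM _ _]
  have h1 : (k : ℝ) < |g q| := hF k q fun i hi => by
    have hiS : i ∈ S := mem_iUnion.2 ⟨k, hi⟩
    rw [hq i (Or.inl hiS), if_pos hiS]
    exact (hu k i hi).2
  have h2 : |g q| < |g h| + 1 := hG q fun i hi => by
    rw [hq i (Or.inr hi)]
    split_ifs with hiS
    exacts [hk i hi hiS, (hw i hi).2]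
  linarith

theorem IsBDiscreteOn.isSigmaPseudocompactSpace_cpRestrict {X : Type*} [TopologicalSpace X]
    {Y : Set X} (hY : IsBDiscreteOn Y) (hX : IsPseudocompactSpace X) :
    IsSigmaPseudocompactSpace (CpRestrict Y) := by
  refine ⟨fun n => {p | ∀ y, |p.1 y| ≤ n}, fun n => ?_, eq_univ_of_forall ?_⟩
  · refine isPseudocompactSpace_of_countable_interpolation
      (φ := fun p : {p : CpRestrict Y | ∀ y, |p.1 y| ≤ n} => p.1.1) (M := n)
      (IsInducing.subtypeVal.comp IsInducing.subtypeVal) (fun p y => p.2 y) fun S hS v hv => ?_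
    obtain ⟨f, hf, hfn, hfS⟩ := hY.exists_continuous_extension hS v n.cast_nonneg hv
    exact ⟨⟨⟨_, f, hf, rfl⟩, fun y => hfn y⟩, hfS⟩
  · rintro ⟨_, f, hf, rfl⟩
    obtain ⟨C, hC⟩ := isBounded_iff_forall_norm_le.1 (hX f hf)
    obtain ⟨n, hn⟩ := exists_nat_ge C
    exact mem_iUnion.2 ⟨n, fun y => (hC _ (mem_range_self _)).trans hn⟩

theorem theorem4p5 {X : Type u} [TopologicalSpace X] [T35Space X] (Y : Set X) (hY : Dense Y) :
    List.TFAE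
      [IsProjectivelyMenger (CpRestrict Y),
        IsSigmaBoundedSpace (CpRestrict Y),
        IsSigmaPseudocompactSpace (CpRestrict Y),
        IsPseudocompactSpace X ∧ IsBDiscreteOn Y] := by
  tfae_have 1 → 4 := fun h => ⟨h.isPseudocompactSpace hY, h.isBDiscreteOn⟩
  tfae_have 4 → 3 := fun h => h.2.isSigmaPseudocompactSpace_cpRestrict h.1
  tfae_have 3 → 2 := IsSigmaPseudocompactSpace.isSigmaBoundedSpace
  tfae_have 2 → 1 := IsSigmaBoundedSpace.isProjectivelyMenger
  tfae_finish
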